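/- Let $\mathbb{K}\in\{\mathbb{R},\mathbb{C}\}$, let $V$ be a Banach space over $\mathbb{K}$ and let $\{W_r\}_{r\in\mathbb{N}}$ be a family of linear subspaces of $V$ such that $\bigcup_{r=1}^{\infty}W_r$ is a non-zero linear subspace of $V$ of infinite codimension. Suppose that for each $r\in\mathbb{N}$ there exist a norm $\|\cdot\|_{W_r}$ on $W_r$ and a constant $C_r>0$ such that $(W_r,\|\cdot\|_{W_r})$ is a Banach space and $\|x\|_V\le C_r\|x\|_{W_r}$ for all $x\in W_r$. Let $\mathfrak{c}=\operatorname{card}(\mathbb{R})$. Then, for every cardinal number $\alpha$, $$V\smallsetminus\bigcup_{r=1}^{\infty}W_r\ \text{ is } (\alpha,\mathfrak{c})\text{-spaceable if and only if } \alpha<\aleph_0 .$$ Here, for cardinals $\alpha,\beta$, a subset $A$ of a topological vector space $E$ is called $(\alpha,\beta)$-spaceable if there is a linear subspace $F$ of $E$ with $\dim F=\alpha$ and $F\smallsetminus\{0\}\subset A$, and for every linear subspace $F_\alpha\subset A\cup\{0\}$ with $\dim F_\alpha=\alpha$ there is a closed linear subspace $F_\beta$ of $E$ with $\dim F_\beta=\beta$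 and $F_\alpha\subset F_\beta\subset A\cup\{0\}$. -/

import Mathlib

open Filter Topology

universe u v

/-- `A` is `α`-lineable: some subspace `F` with `dim F = α` satisfies `F ∖ {0} ⊆ A`. -/
def IsLineable (𝕜 : Type v) {E : Type u} [Field 𝕜] [AddCommGroup E] [Module 𝕜 E]
    (α : Cardinal.{u}) (A : Set E) : Prop :=
  ∃ F : Submodule 𝕜 E, Module.rank 𝕜 F = α ∧ (F : Set E) \ {0} ⊆ A

/-- `A` is `(α, β)`-spaceable: it is `α`-lineable, and every `α`-dimensional subspace contained
in `A ∪ {0}` is contained in a closed `β`-dimensional subspace contained in `A ∪ {0}`.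
(One usually only speaks of this for `α < β ≤ dim E`; the definition makes sense for all
cardinals, and the existence of the larger subspace forces `α ≤ β ≤ dim E`.) -/
def IsPairSpaceable (𝕜 : Type v) {E : Type u} [Field 𝕜] [AddCommGroup E] [Module 𝕜 E]
    [TopologicalSpace E] (α β : Cardinal.{u}) (A : Set E) : Prop :=
  IsLineable 𝕜 α A ∧
    ∀ F : Submodule 𝕜 E, (F : Set E) ⊆ A ∪ {0} → Module.rank 𝕜 F = α →
      ∃ G : Submodule 𝕜 E, Module.rank 𝕜 G = β ∧ IsClosed (G : Set E) ∧
        F ≤ G ∧ (G : Set E) ⊆ A ∪ {0}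

/-- `p` is a norm on `E` for which `E` is a Banach space: `p` is definite and every `p`-Cauchy
sequence is `p`-convergent. No other norm or topology on `E` is involved. -/
structure IsBanachNorm {𝕜 : Type v} {E : Type u} [NormedField 𝕜] [AddCommGroup E] [Module 𝕜 E]
    (p : Seminorm 𝕜 E) : Prop where
  definite : ∀ x : E, p x = 0 → x = 0
  complete : ∀ s : ℕ → E,
    (∀ ε : ℝ, 0 < ε → ∃ N : ℕ, ∀ m n : ℕ, N ≤ m → N ≤ n → p (s m - s n) < ε) →
      ∃ x : E, Tendsto (fun n => p (s n - x)) atTop (𝓝 0)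

/-! Write U for the union. If F is infinite-dimensional and misses U, shrink a sequence of its basis
vectors to 0 and add a nonzero w ∈ U to each. Modulo U this only rescales the basis, so the new span
has the same dimension and misses U, yet w lies in its closure: no closed extension can miss U.
Hence α must be finite.

If F is finite-dimensional, it suffices to find a closed G of dimension 𝔠 meeting every W r + F
trivially, for then G + F is closed and misses U. Such a G lies in the closed span of a biorthogonal
system (u j, h j), where each h j kills F and is small on the unit ball of W (r j). Coordinates of
vectors of G are forced to repeat along infinitely many j for each r, so an element of W r + F in G
has all coordinates zero; Mazur's basic sequence argument makes it zero.

The pairs (u j, h j) exist because otherwise an adjoint would be bounded below, making W r onto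
modulo a finite-dimensional space, contrary to infinite codimension. -/

/-! ### Open-mapping argument via duality. -/

section Surjectivity

variable {𝕜 E Q : Type*} [RCLike 𝕜] [AddCommGroup E] [Module 𝕜 E]
  [NormedAddCommGroup Q] [NormedSpace 𝕜 Q]

/-- If every functional that is bounded by `p` along `T` is bounded by `1` at `q`, then `q` lies in
the closure of the image under `T` of the unit ball of `p`. -/
theorem mem_closure_image_of_dual_bound (p : Seminorm 𝕜 E) (T : E →ₗ[𝕜] Q) (q : Q)
    (h : ∀ g : Q →L[𝕜] 𝕜, (∀ x, ‖g (T x)‖ ≤ p x) → ‖g q‖ ≤ 1) :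
    q ∈ closure (T '' {x | p x ≤ 1}) := by
  let _ : NormedSpace ℝ Q := NormedSpace.restrictScalars ℝ 𝕜 Q
  by_contra hq
  have hconv : Convex ℝ (closure (T '' {x | p x ≤ 1})) := by
    apply Convex.closure
    rintro _ ⟨x, hx, rfl⟩ _ ⟨y, hy, rfl⟩ a b ha hb hab
    refine ⟨(a : 𝕜) • x + (b : 𝕜) • y, ?_, ?_⟩
    · calc p ((a : 𝕜) • x + (b : 𝕜) • y) ≤ p ((a : 𝕜) • x) + p ((b : 𝕜) • y) := map_add_le_add _ _ _
        _ = a * p x + b * p y := by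
          simp [map_smul_eq_mul, abs_of_nonneg ha, abs_of_nonneg hb]
        _ ≤ a * 1 + b * 1 := by
          gcongr
          exacts [hx, hy]
        _ = 1 := by linarith
    · rw [map_add, map_smul, map_smul]
      rfl
  obtain ⟨f, s, hf, hs⟩ :=
    RCLike.geometric_hahn_banach_closed_point (𝕜 := 𝕜) hconv isClosed_closure hq
  have hs0 : 0 < s := by
    have := hf 0 (subset_closure ⟨0, by simp, by simp⟩)
    simpa using this
  have hball : ∀ x, p x ≤ 1 → ‖f (T x)‖ ≤ s := by
    intro x hx
    obtain ⟨c, hc, hcx⟩ := RCLike.exists_norm_eq_mul_self (f (T x))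
    have := hf (T (c • x)) (subset_closure ⟨c • x, by
      simpa [map_smul_eq_mul, hc] using hx, rfl⟩)
    rw [map_smul, map_smul, smul_eq_mul, ← hcx, RCLike.ofReal_re] at this
    exact this.le
  have hall : ∀ x, ‖f (T x)‖ ≤ s * p x := by
    intro x
    have : ∀ t, p x < t → ‖f (T x)‖ ≤ s * t := by
      intro t ht
      have ht0 : 0 < t := (apply_nonneg p x).trans_lt ht
      have h1 := hball (((t⁻¹ : ℝ) : 𝕜) • x) (by
        rw [map_smul_eq_mul, RCLike.norm_ofReal, abs_of_pos (inv_pos.2 ht0), inv_mul_le_one₀ ht0]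
        exact ht.le)
      rw [map_smul, map_smul, norm_smul, RCLike.norm_ofReal, abs_of_pos (inv_pos.2 ht0),
        inv_mul_le_iff₀ ht0] at h1
      linarith
    refine le_of_forall_pos_le_add fun ε hε => ?_
    have := this (p x + ε / s) (by have := div_pos hε hs0; linarith)
    rwa [mul_add, mul_div_cancel₀ _ hs0.ne'] at this
  have key := h (((s⁻¹ : ℝ) : 𝕜) • f) (fun x => by
    rw [smul_apply, norm_smul, RCLike.norm_ofReal, abs_of_pos (inv_pos.2 hs0),
      inv_mul_le_iff₀ hs0]
    exact hall x)
  rw [smul_apply, norm_smul, RCLike.norm_ofReal, abs_of_pos (inv_pos.2 hs0),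
      inv_mul_le_iff₀ hs0, mul_one] at key
  exact absurd (hs.trans_le ((RCLike.re_le_norm _).trans key)) (lt_irrefl _)

/-- A bounded operator out of a Banach space which is onto up to an error of half the norm, with
control of the approximate preimages, is onto. -/
theorem surjective_of_approx_preimage {p : Seminorm 𝕜 E} (hp : IsBanachNorm p) (T : E →ₗ[𝕜] Q)
    {C : ℝ} (hT : ∀ x, ‖T x‖ ≤ C * p x) {K : ℝ} (hK : 0 ≤ K)
    (h : ∀ y : Q, ∃ x, p x ≤ K * ‖y‖ ∧ ‖y - T x‖ ≤ ‖y‖ / 2) : Function.Surjective T := by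
  intro q
  choose φ hφp hφ using h
  let y : ℕ → Q := fun n => Nat.rec q (fun _ z => z - T (φ z)) n
  have y_succ : ∀ n, y (n + 1) = y n - T (φ (y n)) := fun n => rfl
  have y_norm : ∀ n, ‖y n‖ ≤ ‖q‖ * (1 / 2) ^ n := by
    intro n
    induction n with
    | zero => simp [y]
    | succ n ih =>
      rw [y_succ, pow_succ]
      have := hφ (y n)
      linarith
  let s : ℕ → E := fun n => ∑ i ∈ Finset.range n, φ (y i)
  have Ts : ∀ n, T (s n) = q - y n := by
    intro n
    induction n with
    | zero => simp [s, y]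
    | succ n ih =>
      simp only [s, Finset.sum_range_succ, map_add] at ih ⊢
      rw [ih, y_succ]
      abel
  have hK' : 0 ≤ K * ‖q‖ := by positivity
  -- The difference of powers telescopes, so the induction on k closes.
  have inc : ∀ n k, p (s (n + k) - s n) ≤ 2 * (K * ‖q‖) * ((1 / 2) ^ n - (1 / 2) ^ (n + k)) := by
    intro n k
    induction k with
    | zero => simp
    | succ k ih =>
      have e : s (n + (k + 1)) - s n = (s (n + k) - s n) + φ (y (n + k)) := by
        simp only [s, ← add_assoc, Finset.sum_range_succ]
        abel
      rw [e]
      have h1 := (map_add_le_add p (s (n + k) - s n) (φ (y (n + k))))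
      have h2 := (hφp (y (n + k))).trans (mul_le_mul_of_nonneg_left (y_norm (n + k)) hK)
      have h3 : ((1 : ℝ) / 2) ^ (n + (k + 1)) = (1 / 2) ^ (n + k) / 2 := by
        rw [← add_assoc, pow_succ]; ring
      rw [h3]
      nlinarith
  have inc' : ∀ n k, p (s (n + k) - s n) ≤ 2 * (K * ‖q‖) * (1 / 2) ^ n := fun n k =>
    (inc n k).trans (mul_le_mul_of_nonneg_left (by
      have : (0 : ℝ) ≤ (1 / 2) ^ (n + k) := by positivity
      linarith) (by positivity))
  have lim0 : ∀ c : ℝ, Tendsto (fun n : ℕ => c * (1 / 2 : ℝ) ^ n) atTop (𝓝 0) := fun c => by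
    simpa using (tendsto_pow_atTop_nhds_zero_of_lt_one (r := (1 / 2 : ℝ)) (by norm_num)
      (by norm_num)).const_mul c
  obtain ⟨x, hx⟩ := hp.complete s (by
    intro ε hε
    obtain ⟨N, hN⟩ := ((lim0 (2 * (K * ‖q‖))).eventually_lt_const (half_pos hε)).exists
    refine ⟨N, fun m n hm hn => ?_⟩
    obtain ⟨k, rfl⟩ := Nat.exists_eq_add_of_le hm
    obtain ⟨l, rfl⟩ := Nat.exists_eq_add_of_le hn
    have h1 := map_sub_le_add p (s (N + k) - s N) (s (N + l) - s N)
    rw [sub_sub_sub_cancel_right] at h1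
    linarith [inc' N k, inc' N l])
  refine ⟨x, ?_⟩
  have l1 : Tendsto (fun n => T (s n)) atTop (𝓝 (T x)) := by
    rw [tendsto_iff_norm_sub_tendsto_zero]
    refine squeeze_zero (fun _ => norm_nonneg _) (fun n => ?_) (by simpa using hx.const_mul C)
    rw [← map_sub]
    exact hT _
  have l2 : Tendsto (fun n => T (s n)) atTop (𝓝 q) := by
    rw [tendsto_iff_norm_sub_tendsto_zero]
    refine squeeze_zero (fun _ => norm_nonneg _) (fun n => ?_) (lim0 ‖q‖)
    rw [Ts, sub_sub_cancel_left, norm_neg]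
    exact y_norm n
  exact tendsto_nhds_unique l1 l2

/-- A bounded operator out of a Banach space is onto if its adjoint is bounded below. -/
theorem surjective_of_dual_bound {p : Seminorm 𝕜 E} (hp : IsBanachNorm p) (T : E →ₗ[𝕜] Q)
    {C : ℝ} (hT : ∀ x, ‖T x‖ ≤ C * p x) {δ : ℝ} (hδ : 0 < δ)
    (h : ∀ g : Q →L[𝕜] 𝕜, (∀ x, ‖g (T x)‖ ≤ p x) → ∀ q, ‖q‖ ≤ δ → ‖g q‖ ≤ 1) :
    Function.Surjective T := by
  refine surjective_of_approx_preimage hp T hT (K := δ⁻¹) (by positivity) fun y => ?_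
  rcases eq_or_ne y 0 with rfl | hy
  · exact ⟨0, by simp, by simp⟩
  have hy' : 0 < ‖y‖ := norm_pos_iff.2 hy
  set t : ℝ := δ * ‖y‖⁻¹ with ht
  have ht0 : 0 < t := by positivity
  have hmem := mem_closure_image_of_dual_bound p T ((t : 𝕜) • y) fun g hg => h g hg _ (by
    rw [norm_smul, RCLike.norm_ofReal, abs_of_pos ht0, ht, mul_assoc, inv_mul_cancel₀ hy'.ne',
      mul_one])
  obtain ⟨_, ⟨x, hx, rfl⟩, hd⟩ := Metric.mem_closure_iff.1 hmem (δ / 2) (half_pos hδ)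
  refine ⟨((t⁻¹ : ℝ) : 𝕜) • x, ?_, ?_⟩
  · rw [map_smul_eq_mul, RCLike.norm_ofReal, abs_of_pos (inv_pos.2 ht0), ht, mul_inv, inv_inv]
    exact mul_le_of_le_one_right (by positivity) hx
  · have e : y - T (((t⁻¹ : ℝ) : 𝕜) • x) = ((t⁻¹ : ℝ) : 𝕜) • ((t : 𝕜) • y - T x) := by
      rw [smul_sub, smul_smul, ← RCLike.ofReal_mul, inv_mul_cancel₀ ht0.ne', RCLike.ofReal_one,
        one_smul, map_smul]
    rw [e, norm_smul, RCLike.norm_ofReal, abs_of_pos (inv_pos.2 ht0), inv_mul_le_iff₀ ht0]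
    rw [dist_eq_norm] at hd
    refine hd.le.trans_eq ?_
    rw [ht]
    field_simp

end Surjectivity

/-! ### Almost orthogonal subspaces. -/

section Mazur

variable {𝕜 V : Type*} [RCLike 𝕜] [NormedAddCommGroup V] [NormedSpace 𝕜 V]

/-- Mazur's lemma: a finite-dimensional subspace `E` is almost orthogonal to a closed subspace of
finite codimension. -/
theorem exists_isClosed_coFG_norm_le_two_mul (E : Submodule 𝕜 V) [FiniteDimensional 𝕜 E] :
    ∃ Y : Submodule 𝕜 V, IsClosed (Y : Set V) ∧ Y.CoFG ∧
      ∀ e ∈ E, ∀ y ∈ Y, ‖e‖ ≤ 2 * ‖e + y‖ := by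
  have : ProperSpace E := FiniteDimensional.proper_rclike 𝕜 E
  choose g hg1 hg using fun x : V => exists_dual_vector'' 𝕜 x
  obtain ⟨t, htS, htfin, ht⟩ :=
    (isCompact_sphere (0 : E) 1).finite_cover_balls (e := 1 / 2) (by norm_num)
  -- Y is the common kernel of norming functionals of a finite 1/2-net of the unit sphere of E. A
  -- unit e is within 1/2 of some net point x, so |g x e| ≥ 1/2, and adding y ∈ Y does not change g
  -- x e.
  refine ⟨sInf ((fun x : E => LinearMap.ker (g x : V →ₗ[𝕜] 𝕜)) '' t), ?_, ?_, ?_⟩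
  · simp only [sInf_image, Submodule.coe_iInf]
    exact isClosed_biInter fun x _ => (g x).isClosed_ker
  · refine Submodule.CoFG.sInf_of_finite (htfin.image _) ?_
    rintro _ ⟨x, -, rfl⟩
    exact Submodule.CoFG.ker _
  · intro e he y hy
    rcases eq_or_ne e 0 with rfl | he0
    · simp
    have hpos : 0 < ‖e‖ := norm_pos_iff.2 he0
    have hnorm : ‖((‖e‖⁻¹ : ℝ) : 𝕜) • e‖ = 1 := by
      rw [norm_smul, RCLike.norm_ofReal, abs_of_pos (inv_pos.2 hpos), inv_mul_cancel₀ hpos.ne']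
    obtain ⟨x, hxt, hx⟩ := Set.mem_iUnion₂.1
      (ht (show (((‖e‖⁻¹ : ℝ) : 𝕜) • (⟨e, he⟩ : E)) ∈ Metric.sphere (0 : E) 1 by
        rw [mem_sphere_zero_iff_norm]; exact hnorm))
    have hxe : ‖((‖e‖⁻¹ : ℝ) : 𝕜) • e - (x : V)‖ < 1 / 2 := by
      rw [Metric.mem_ball, dist_eq_norm] at hx
      exact hx
    have hgy : g x y = 0 :=
      (Submodule.mem_sInf.1 hy) _ ⟨x, hxt, rfl⟩
    have bound : ∀ z, ‖g x z‖ ≤ ‖z‖ := fun z => by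
      simpa using (g x).le_of_opNorm_le (hg1 x) z
    have h1 : ‖(x : V)‖ ≤ ‖g x (((‖e‖⁻¹ : ℝ) : 𝕜) • e)‖ + 1 / 2 := by
      have : ‖g x (x : V)‖ = ‖(x : V)‖ := by rw [hg]; simp
      rw [← this]
      have h2 := bound (((‖e‖⁻¹ : ℝ) : 𝕜) • e - (x : V))
      rw [map_sub] at h2
      have h3 := norm_sub_norm_le (g x (x : V)) (g x (((‖e‖⁻¹ : ℝ) : 𝕜) • e))
      rw [norm_sub_rev] at h3
      linarith
    have hx1 : ‖(x : V)‖ = 1 := by simpa using htS hxt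
    rw [hx1, map_smul, norm_smul, RCLike.norm_ofReal, abs_of_pos (inv_pos.2 hpos)] at h1
    have h2 : ‖e‖ ≤ ‖g x e‖ + ‖e‖ / 2 := by
      have := mul_le_mul_of_nonneg_left h1 hpos.le
      rw [mul_add, mul_inv_cancel_left₀ hpos.ne'] at this
      linarith
    have h3 := bound (e + y)
    rw [map_add, hgy, add_zero] at h3
    linarith

end Mazur

/-! ### Separating one subspace of infinite codimension. -/

section Separation

variable {𝕜 V : Type*} [RCLike 𝕜] [NormedAddCommGroup V] [NormedSpace 𝕜 V]

/-- Let `W` be a subspace of infinite codimension which is a Banach space for a norm `p` stronger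
than that of `V`. Then there are a vector `u` of small norm in a prescribed closed subspace `Y` of
finite codimension and a functional `h` with `h u = 1` which is small on the unit ball of `p` and
vanishes on a prescribed finite-dimensional subspace. -/
theorem exists_functional_vector_of_not_coFG {W : Submodule 𝕜 V} (hW : ¬ W.CoFG)
    {p : Seminorm 𝕜 W} (hp : IsBanachNorm p) {C : ℝ} (hC : ∀ x : W, ‖(x : V)‖ ≤ C * p x)
    (E : Submodule 𝕜 V) [FiniteDimensional 𝕜 E]
    {Y : Submodule 𝕜 V} (hY : IsClosed (Y : Set V)) (hYc : Y.CoFG) {ε η : ℝ}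
    (hε : 0 < ε) (hη : 0 < η) :
    ∃ (h : V →L[𝕜] 𝕜) (u : V), h u = 1 ∧ u ∈ Y ∧ ‖u‖ ≤ ε ∧ (∀ e ∈ E, h e = 0) ∧
      ∀ w : W, ‖h w‖ ≤ η * p w := by
  by_contra! hcon
  -- Functionals on V/(E + Z) kill E, and also Z, so they take the same value at v and at its
  -- projection to Y.
  obtain ⟨Z, hYZ⟩ := Y.exists_isCompl
  have hZ : FiniteDimensional 𝕜 Z := .of_fg (Submodule.CoFG.fg_of_isCompl hYZ hYc)
  have htop := Submodule.IsCompl.isTopCompl_of_finiteDimensional_quotient hYZ hY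
  set π : V →L[𝕜] V := Y.projectionL Z htop with hπ
  set H : Submodule 𝕜 V := E ⊔ Z with hH
  have hHclosed : IsClosed (H : Set V) := H.closed_of_finiteDimensional
  set T : W →ₗ[𝕜] V ⧸ H := H.mkQ ∘ₗ W.subtype with hTdef
  set K : ℝ := ‖π‖ + 1 with hK
  have hK0 : 0 < K := by positivity
  have hsurj : Function.Surjective T := by
    refine surjective_of_dual_bound hp T (C := C) (fun x => ?_) (δ := ε * η / K / 2)
      (by positivity) ?_
    · exact (Submodule.Quotient.norm_mk_le H (x : V)).trans (hC x)
    intro g hg q hq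
    by_contra! hgq
    obtain ⟨v, rfl, hv⟩ := Submodule.Quotient.norm_mk_lt q (ε := ε * η / K / 2) (by positivity)
    have hv' : ‖v‖ ≤ ε * η / K := by linarith
    set f : V →L[𝕜] 𝕜 := g ∘L H.mkQL with hf
    have hfH : ∀ x ∈ H, f x = 0 := fun x hx => by
      have : H.mkQ x = 0 := (Submodule.Quotient.mk_eq_zero H).2 hx
      simp [hf, this]
    have hfv : f (π v) = f v := by
      have : v - π v ∈ Z := by
        rw [hπ, ← Submodule.projectionL_eq_self_sub_projectionL]
        exact Submodule.projectionL_apply_mem _ _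
      have := hfH _ ((le_sup_right : Z ≤ H) this)
      rw [map_sub, sub_eq_zero] at this
      exact this.symm
    have hfv1 : 1 < ‖f v‖ := hgq
    have hfv0 : f v ≠ 0 := fun h0 => by simp [h0] at hfv1; linarith
    -- The scaling makes the pairing 1, and |f v| > 1 gives norm at most ε; the resulting w violates
    -- the bound on g.
    obtain ⟨w, hw⟩ := hcon ((η : 𝕜) • f) (((η : 𝕜) * f v)⁻¹ • π v) (by
        have : (η : 𝕜) ≠ 0 := by exact_mod_cast hη.ne'
        rw [smul_apply, map_smul, hfv, smul_eq_mul, smul_eq_mul]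
        field_simp)
      (Y.smul_mem _ (Submodule.projectionL_apply_mem _ _))
      (by
        rw [norm_smul, norm_inv, norm_mul, RCLike.norm_ofReal, abs_of_pos hη,
          inv_mul_le_iff₀ (by positivity)]
        calc ‖π v‖ ≤ ‖π‖ * ‖v‖ := π.le_opNorm v
          _ ≤ K * (ε * η / K) := by gcongr; linarith
          _ = η * 1 * ε := by field_simp
          _ ≤ η * ‖f v‖ * ε := by gcongr)
      (fun e he => by rw [smul_apply, hfH e ((le_sup_left : E ≤ H) he), smul_zero])
    refine absurd hw (not_lt.2 ?_)
    rw [smul_apply, norm_smul, RCLike.norm_ofReal, abs_of_pos hη]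
    exact mul_le_mul_of_nonneg_left (hg w) hη.le
  apply hW
  have hHfg : H.FG := Submodule.fg_iff_finiteDimensional H |>.2 inferInstance
  refine hHfg.cofg_of_codisjoint ?_
  rw [codisjoint_iff, eq_top_iff]
  rintro v -
  obtain ⟨w, hw⟩ := hsurj (H.mkQ v)
  have : v - (w : V) ∈ H := by
    rw [← Submodule.Quotient.mk_eq_zero, Submodule.Quotient.mk_sub, sub_eq_zero]
    exact hw.symm
  rw [← sub_add_cancel v (w : V)]
  exact Submodule.add_mem_sup this w.2

end Separation

/-! ### Biorthogonal systems. -/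

section BasicSequence

variable {𝕜 V : Type*} [RCLike 𝕜] [NormedAddCommGroup V] [NormedSpace 𝕜 V]

/-- The functionals of a biorthogonal system separate the points of the closed linear span, as soon
as the heads and tails of the system are almost orthogonal. -/
theorem eq_zero_of_forall_coord_eq_zero {E Y : ℕ → Submodule 𝕜 V} (hE : Monotone E)
    (hY : Antitone Y) (hEY : ∀ j, ∀ e ∈ E j, ∀ y ∈ Y j, ‖e‖ ≤ 2 * ‖e + y‖)
    {h : ℕ → V →L[𝕜] 𝕜} {u : ℕ → V} (hu : ∀ i j, h i (u j) = if i = j then 1 else 0)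
    (huE : ∀ j, u j ∈ E (j + 1)) (huY : ∀ j, u j ∈ Y j) {x : V}
    (hx : x ∈ (Submodule.span 𝕜 (Set.range u)).topologicalClosure) (hx0 : ∀ j, h j x = 0) :
    x = 0 := by
  -- Partial-sum projections. On the span, P k z lies in the head E k and z - P k z in the tail Y k,
  -- so almost orthogonality bounds P k by 2 there, hence on the closure.
  let P : ℕ → V →L[𝕜] V := fun k => ∑ j ∈ Finset.range k, (h j).smulRight (u j)
  have P_apply : ∀ k z, P k z = ∑ j ∈ Finset.range k, h j z • u j := fun k z => by
    simp [P]
  have P_lt : ∀ k j, j < k → P k (u j) = u j := fun k j hj => by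
    simp [P_apply, hu, hj]
  have P_ge : ∀ k j, k ≤ j → P k (u j) = 0 := fun k j hj => by
    simp [P_apply, hu, hj]
  have P_mem : ∀ k z, P k z ∈ E k := fun k z => by
    rw [P_apply]
    exact Submodule.sum_mem _ fun j hj =>
      Submodule.smul_mem _ _ (hE (Finset.mem_range.1 hj) (huE j))
  have sub_P_mem : ∀ k, ∀ z ∈ Submodule.span 𝕜 (Set.range u), z - P k z ∈ Y k := by
    intro k z hz
    induction hz using Submodule.span_induction with
    | mem z hz =>
      obtain ⟨j, rfl⟩ := hz
      rcases lt_or_ge j k with hj | hj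
      · simp [P_lt k j hj]
      · simpa [P_ge k j hj] using hY hj (huY j)
    | zero => simp
    | add a b _ _ ha hb =>
      rw [map_add, add_sub_add_comm]
      exact add_mem ha hb
    | smul c a _ ha =>
      rw [map_smul, ← smul_sub]
      exact Submodule.smul_mem _ _ ha
  have P_bound : ∀ k, ∀ z ∈ (Submodule.span 𝕜 (Set.range u)).topologicalClosure,
      ‖P k z‖ ≤ 2 * ‖z‖ := by
    intro k z hz
    have hcl : IsClosed {z | ‖P k z‖ ≤ 2 * ‖z‖} :=
      isClosed_le (P k).continuous.norm (continuous_const.mul continuous_norm)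
    refine closure_minimal (fun z hz => ?_) hcl hz
    simpa using hEY k _ (P_mem k z) _ (sub_P_mem k z hz)
  have P_eventually : ∀ z ∈ Submodule.span 𝕜 (Set.range u), ∀ᶠ k in atTop, P k z = z := by
    intro z hz
    induction hz using Submodule.span_induction with
    | mem z hz =>
      obtain ⟨j, rfl⟩ := hz
      filter_upwards [eventually_gt_atTop j] with k hk using P_lt k j hk
    | zero => simp
    | add a b _ _ ha hb =>
      filter_upwards [ha, hb] with k h1 h2
      rw [map_add, h1, h2]
    | smul c a _ ha =>
      filter_upwards [ha] with k h1
      rw [map_smul, h1]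
  rw [← norm_le_zero_iff]
  refine le_of_forall_pos_le_add fun ε hε => ?_
  obtain ⟨y, hy, hxy⟩ := Metric.mem_closure_iff.1 hx (ε / 3) (by positivity)
  obtain ⟨k, hk⟩ := (P_eventually y hy).exists
  have hPx : P k x = 0 := by simp [P_apply, hx0]
  have h1 := P_bound k (y - x) (sub_mem (Submodule.le_topologicalClosure _ hy) hx)
  rw [map_sub, hPx, sub_zero, hk, norm_sub_rev] at h1
  rw [dist_eq_norm] at hxy
  have h2 := norm_le_norm_sub_add x y
  linarith

/-- Given countably many subspaces of infinite codimension that are Banach spaces for stronger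
norms, there is a biorthogonal system whose functionals vanish on a given finite-dimensional
subspace, separate the points of the closed span, and whose `j`-th functional is at most
`η j` on the unit ball of the `r j`-th subspace. -/
theorem exists_biorthogonal_small {W : ℕ → Submodule 𝕜 V} (hW : ∀ r, ¬ (W r).CoFG)
    {p : ∀ r, Seminorm 𝕜 (W r)} (hp : ∀ r, IsBanachNorm (p r)) {C : ℕ → ℝ}
    (hC : ∀ r, ∀ x : W r, ‖(x : V)‖ ≤ C r * p r x)
    (F : Submodule 𝕜 V) [FiniteDimensional 𝕜 F] (r : ℕ → ℕ) {ε η : ℕ → ℝ}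
    (hε : ∀ j, 0 < ε j) (hη : ∀ j, 0 < η j) :
    ∃ (h : ℕ → V →L[𝕜] 𝕜) (u : ℕ → V), (∀ i j, h i (u j) = if i = j then 1 else 0) ∧
      (∀ j, ‖u j‖ ≤ ε j) ∧ (∀ j, ∀ f ∈ F, h j f = 0) ∧
      (∀ j, ∀ w : W (r j), ‖h j w‖ ≤ η j * p (r j) w) ∧
      ∀ x ∈ (Submodule.span 𝕜 (Set.range u)).topologicalClosure, (∀ j, h j x = 0) → x = 0 := by
  let State := {S : Submodule 𝕜 V × Submodule 𝕜 V // FiniteDimensional 𝕜 S.1 ∧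
    IsClosed (S.2 : Set V) ∧ S.2.CoFG ∧ ∀ e ∈ S.1, ∀ y ∈ S.2, ‖e‖ ≤ 2 * ‖e + y‖}
  have step : ∀ (j : ℕ) (S : State), ∃ (S' : State) (h : V →L[𝕜] 𝕜) (u : V),
      S.1.1 ≤ S'.1.1 ∧ S'.1.2 ≤ S.1.2 ∧ u ∈ S'.1.1 ∧ u ∈ S.1.2 ∧ h u = 1 ∧
      (∀ e ∈ S.1.1, h e = 0) ∧ (∀ y ∈ S'.1.2, h y = 0) ∧ ‖u‖ ≤ ε j ∧
      ∀ w : W (r j), ‖h w‖ ≤ η j * p (r j) w := by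
    rintro j ⟨⟨E, Y⟩, hE, hYcl, hYc, hEY⟩
    obtain ⟨h, u, h1, h2, h3, h4, h5⟩ := exists_functional_vector_of_not_coFG (hW (r j))
      (hp (r j)) (hC (r j)) E hYcl hYc (hε j) (hη j)
    obtain ⟨Z, hZcl, hZc, hZ⟩ :=
      exists_isClosed_coFG_norm_le_two_mul (E ⊔ Submodule.span 𝕜 {u})
    -- Cutting the tail by ker h makes h vanish at all later vectors; h already vanishes at the
    -- earlier ones, which lie in E.
    refine ⟨⟨⟨E ⊔ Submodule.span 𝕜 {u}, Y ⊓ (LinearMap.ker (h : V →ₗ[𝕜] 𝕜) ⊓ Z)⟩, inferInstance,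
      hYcl.inter (h.isClosed_ker.inter hZcl), hYc.inf ((Submodule.CoFG.ker _).inf hZc),
      fun e he y hy => hZ e he y hy.2.2⟩, h, u, le_sup_left, inf_le_left,
      (le_sup_right : _ ≤ E ⊔ Submodule.span 𝕜 {u}) (Submodule.mem_span_singleton_self u),
      h2, h1, h4, fun y hy => hy.2.1, h3, h5⟩
  choose next h u le_next next_le hu_next hu_mem hu_one hE_zero hY_zero hu_norm hbound using step
  obtain ⟨Y₀, hY₀cl, hY₀c, hY₀⟩ := exists_isClosed_coFG_norm_le_two_mul F
  let S : ℕ → State := fun n =>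
    Nat.rec ⟨⟨F, Y₀⟩, inferInstance, hY₀cl, hY₀c, hY₀⟩ (fun j T => next j T) n
  have hEmono : Monotone fun j => (S j).1.1 := monotone_nat_of_le_succ fun j => le_next j (S j)
  have hYanti : Antitone fun j => (S j).1.2 := antitone_nat_of_succ_le fun j => next_le j (S j)
  have hbi : ∀ i j, h i (S i) (u j (S j)) = if i = j then 1 else 0 := by
    intro i j
    rcases lt_trichotomy i j with hij | rfl | hij
    · rw [if_neg hij.ne]
      exact hY_zero i (S i) _ (hYanti hij (hu_mem j (S j)))
    · rw [if_pos rfl]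
      exact hu_one i (S i)
    · rw [if_neg hij.ne']
      exact hE_zero i (S i) _ (hEmono hij (hu_next j (S j)))
  exact ⟨fun j => h j (S j), fun j => u j (S j), hbi, fun j => hu_norm j (S j),
    fun j f hf => hE_zero j (S j) f (hEmono (Nat.zero_le j) hf), fun j => hbound j (S j),
    fun x hx hx0 => eq_zero_of_forall_coord_eq_zero hEmono hYanti (fun j => (S j).2.2.2.2) hbi
      (fun j => hu_next j (S j)) (fun j => hu_mem j (S j)) hx hx0⟩

end BasicSequence

/-! ### The closed subspace of dimension continuum. -/

section Spaceable

variable {𝕜 : Type v} {V : Type u} [RCLike 𝕜] [NormedAddCommGroup V] [NormedSpace 𝕜 V]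

/-- The vectors of the closed span of `u` whose coordinates depend only on the class of the index
under `c`. -/
def coordClassSubmodule (h : ℕ → V →L[𝕜] 𝕜) (u : ℕ → V) (c : ℕ → ℕ) : Submodule 𝕜 V :=
  (Submodule.span 𝕜 (Set.range u)).topologicalClosure ⊓
    ⨅ (i : ℕ) (j : ℕ) (_ : c i = c j), LinearMap.ker ((h i - h j : V →L[𝕜] 𝕜) : V →ₗ[𝕜] 𝕜)

theorem mem_coordClassSubmodule {h : ℕ → V →L[𝕜] 𝕜} {u : ℕ → V} {c : ℕ → ℕ} {x : V} :
    x ∈ coordClassSubmodule h u c ↔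
      x ∈ (Submodule.span 𝕜 (Set.range u)).topologicalClosure ∧
        ∀ i j, c i = c j → h i x = h j x := by
  simp [coordClassSubmodule, Submodule.mem_iInf, sub_eq_zero]

theorem isClosed_coordClassSubmodule (h : ℕ → V →L[𝕜] 𝕜) (u : ℕ → V) (c : ℕ → ℕ) :
    IsClosed (coordClassSubmodule h u c : Set V) := by
  rw [coordClassSubmodule, Submodule.coe_inf]
  refine (Submodule.isClosed_topologicalClosure _).inter ?_
  simp only [Submodule.coe_iInf]
  exact isClosed_iInter fun i => isClosed_iInter fun j => isClosed_iInter fun _ =>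
    (h i - h j).isClosed_ker

/-- A vector space with a countable separating family of functionals has dimension at most the
continuum. -/
theorem rank_le_continuum_of_separating {M : Type u} [AddCommGroup M] [Module 𝕜 M]
    (h : ℕ → M →ₗ[𝕜] 𝕜) (hsep : ∀ x, (∀ j, h j x = 0) → x = 0) :
    Module.rank 𝕜 M ≤ Cardinal.continuum := by
  refine (rank_le_card 𝕜 M).trans ?_
  let Φ : M → ℕ → ℝ × ℝ := fun x j => (RCLike.re (h j x), RCLike.im (h j x))
  have hΦ : Function.Injective Φ := by
    intro x y hxy
    rw [← sub_eq_zero]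
    refine hsep _ fun j => ?_
    rw [map_sub, sub_eq_zero]
    have := congrFun hxy j
    simp only [Φ, Prod.mk.injEq] at this
    exact RCLike.ext this.1 this.2
  have := Cardinal.mk_le_of_injective (Function.Injective.comp Equiv.ulift.{u}.symm.injective hΦ)
  simpa [Cardinal.mk_real] using this

/-- The dimension of `coordClassSubmodule` is at least the continuum. -/
theorem continuum_le_rank_coordClassSubmodule [CompleteSpace V] {h : ℕ → V →L[𝕜] 𝕜} {u : ℕ → V}
    (hu : ∀ i j, h i (u j) = if i = j then 1 else 0) (hsum : Summable fun j => ‖u j‖)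
    {c : ℕ → ℕ} (hc : Function.Surjective c) :
    Cardinal.continuum ≤ Module.rank 𝕜 (coordClassSubmodule h u c) := by
  have hs : ∀ t : Set.Ioo (0 : ℝ) 1, Summable fun j => ((t : ℝ) : 𝕜) ^ c j • u j := fun t => by
    refine Summable.of_norm_bounded hsum fun j => ?_
    rw [norm_smul, norm_pow, RCLike.norm_ofReal, abs_of_pos t.2.1]
    exact mul_le_of_le_one_left (norm_nonneg _) (pow_le_one₀ t.2.1.le t.2.2.le)
  have hcoord : ∀ (t : Set.Ioo (0 : ℝ) 1) i,
      h i (∑' j, ((t : ℝ) : 𝕜) ^ c j • u j) = ((t : ℝ) : 𝕜) ^ c i := fun t i => by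
    rw [(h i).map_tsum (hs t), tsum_eq_single i]
    · simp [hu]
    · intro j hj
      simp [hu, hj.symm]
  let x : Set.Ioo (0 : ℝ) 1 → coordClassSubmodule h u c := fun t =>
    ⟨∑' j, ((t : ℝ) : 𝕜) ^ c j • u j, by
      rw [mem_coordClassSubmodule]
      refine ⟨?_, fun i j hij => by rw [hcoord, hcoord, hij]⟩
      refine (Submodule.isClosed_topologicalClosure _).mem_of_tendsto (hs t).hasSum
        (Eventually.of_forall fun s => ?_)
      exact Submodule.le_topologicalClosure _ (Submodule.sum_mem _ fun j _ =>
        Submodule.smul_mem _ _ (Submodule.subset_span ⟨j, rfl⟩))⟩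
  obtain ⟨d, hd⟩ := hc.hasRightInverse
  -- Reading one coordinate per class sends `x t` to the character n ↦ t ^ n; distinct characters
  -- are independent.
  let L : coordClassSubmodule h u c →ₗ[𝕜] (Multiplicative ℕ → 𝕜) :=
    LinearMap.pi fun n => (h (d n.toAdd) : V →ₗ[𝕜] 𝕜) ∘ₗ Submodule.subtype _
  have hL : ∀ t, L (x t) = (powersHom 𝕜 ((t : ℝ) : 𝕜) : Multiplicative ℕ → 𝕜) := fun t => by
    ext n
    have := hcoord t (d n.toAdd)
    rw [hd] at this
    simpa [L, x, powersHom_apply] using this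
  have hinj : Function.Injective fun t : Set.Ioo (0 : ℝ) 1 => powersHom 𝕜 ((t : ℝ) : 𝕜) :=
    (powersHom 𝕜).injective.comp (RCLike.ofReal_injective.comp Subtype.val_injective)
  have hli : LinearIndependent 𝕜 x := by
    refine LinearIndependent.of_comp L ?_
    have := (linearIndependent_monoidHom (Multiplicative ℕ) 𝕜).comp _ hinj
    rwa [show L ∘ x = _ from funext hL]
  have := hli.cardinal_lift_le_rank
  rwa [Cardinal.mk_Ioo_real one_pos, Cardinal.lift_continuum, Cardinal.lift_id'] at this

/-- Let `W r` be countably many subspaces of infinite codimension that are Banach spaces for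
stronger norms, and `F` a finite-dimensional subspace. Then there is a closed subspace of dimension
continuum that meets each `W r + F` trivially. -/
theorem exists_isClosed_rank_eq_continuum [CompleteSpace V] {W : ℕ → Submodule 𝕜 V}
    (hW : ∀ r, ¬ (W r).CoFG) {p : ∀ r, Seminorm 𝕜 (W r)} (hp : ∀ r, IsBanachNorm (p r)) {C : ℕ → ℝ}
    (hC : ∀ r, ∀ x : W r, ‖(x : V)‖ ≤ C r * p r x) (F : Submodule 𝕜 V) [FiniteDimensional 𝕜 F] :
    ∃ G : Submodule 𝕜 V, IsClosed (G : Set V) ∧ Module.rank 𝕜 G = Cardinal.continuum ∧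
      ∀ r, Disjoint G (W r ⊔ F) := by
  -- An index j codes (class, subspace, k); the free k gives every class infinitely many indices for
  -- every subspace.
  let c : ℕ → ℕ := fun j => j.unpair.1
  let r : ℕ → ℕ := fun j => j.unpair.2.unpair.1
  obtain ⟨h, u, hu, hun, hF, hsmall, hsep⟩ := exists_biorthogonal_small hW hp hC F r
    (ε := fun j => (1 / 2) ^ j) (η := fun j => ((j : ℝ) + 1)⁻¹) (fun j => by positivity)
    (fun j => by positivity)
  have hsum : Summable fun j => ‖u j‖ :=
    Summable.of_nonneg_of_le (fun _ => norm_nonneg _) hun summable_geometric_two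
  have hc : Function.Surjective c := fun n => ⟨Nat.pair n 0, by simp [c]⟩
  refine ⟨coordClassSubmodule h u c, isClosed_coordClassSubmodule h u c,
    le_antisymm ?_ (continuum_le_rank_coordClassSubmodule hu hsum hc), fun s => ?_⟩
  · refine rank_le_continuum_of_separating
      (fun j => (h j : V →ₗ[𝕜] 𝕜) ∘ₗ Submodule.subtype _) fun x hx => ?_
    exact Subtype.ext (hsep x (mem_coordClassSubmodule.1 x.2).1 hx)
  · rw [Submodule.disjoint_def]
    intro x hxG hxW
    rw [mem_coordClassSubmodule] at hxG
    obtain ⟨w, hw, f, hf, rfl⟩ := Submodule.mem_sup.1 hxW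
    refine hsep _ hxG.1 fun i => ?_
    rw [← norm_le_zero_iff]
    have hle : ∀ k : ℕ, ‖h i (w + f)‖ ≤ p s ⟨w, hw⟩ * ((k : ℝ) + 1)⁻¹ := by
      intro k
      set j := Nat.pair (c i) (Nat.pair s k) with hj
      have hrj : r j = s := by simp [r, hj]
      have hkj : k ≤ j := (Nat.right_le_pair _ _).trans (Nat.right_le_pair _ _)
      have key : ∀ s' (hs' : s' = s), (∀ w : W s', ‖h j w‖ ≤ ((j : ℝ) + 1)⁻¹ * p s' w) →
          ‖h j w‖ ≤ ((j : ℝ) + 1)⁻¹ * p s ⟨w, hw⟩ := by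
        rintro s' rfl hs'
        exact hs' ⟨w, hw⟩
      rw [hxG.2 i j (by simp [c, hj]), map_add, hF j f hf, add_zero]
      refine (key _ hrj (hsmall j)).trans ?_
      rw [mul_comm]
      gcongr
    have hlim : Tendsto (fun k : ℕ => p s ⟨w, hw⟩ * ((k : ℝ) + 1)⁻¹) atTop (𝓝 0) := by
      simpa using (tendsto_one_div_add_atTop_nhds_zero_nat (𝕜 := ℝ)).const_mul (p s ⟨w, hw⟩)
    exact ge_of_tendsto' hlim hle

end Spaceable

/-! ### Subspaces meeting U trivially. -/

section Lineable

variable {𝕜 : Type v} {V : Type u} [Field 𝕜] [AddCommGroup V] [Module 𝕜 V]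

theorem coe_subset_compl_union_zero_iff {F U : Submodule 𝕜 V} :
    (F : Set V) ⊆ Set.univ \ (U : Set V) ∪ {0} ↔ Disjoint F U := by
  rw [Submodule.disjoint_def]
  refine forall_congr' fun x => forall_congr' fun _ => ?_
  simp only [Set.mem_union, Set.mem_sdiff, Set.mem_univ, true_and, SetLike.mem_coe,
    Set.mem_singleton_iff]
  tauto

theorem coe_diff_zero_subset_compl_iff {F U : Submodule 𝕜 V} :
    (F : Set V) \ {0} ⊆ Set.univ \ (U : Set V) ↔ Disjoint F U := by
  rw [Submodule.disjoint_def]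
  refine forall_congr' fun x => ?_
  simp only [Set.mem_sdiff, Set.mem_univ, true_and, SetLike.mem_coe, Set.mem_singleton_iff]
  tauto

/-- A family that is linearly independent modulo `U` spans a subspace meeting `U` trivially. -/
theorem disjoint_span_of_linearIndependent_mkQ {ι : Type*} {U : Submodule 𝕜 V} {b : ι → V}
    (hb : LinearIndependent 𝕜 (U.mkQ ∘ b)) : Disjoint (Submodule.span 𝕜 (Set.range b)) U := by
  simpa using Submodule.range_ker_disjoint hb

theorem exists_rank_eq_disjoint {U : Submodule 𝕜 V} {α : Cardinal.{u}}
    (hα : α ≤ Module.rank 𝕜 (V ⧸ U)) :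
    ∃ F : Submodule 𝕜 V, Module.rank 𝕜 F = α ∧ Disjoint F U := by
  obtain ⟨s, hs, hli⟩ := le_rank_iff_exists_linearIndependent.1 hα
  choose b hb using fun x : s => U.mkQ_surjective x.1
  have hb' : LinearIndependent 𝕜 (U.mkQ ∘ b) := by
    rw [show U.mkQ ∘ b = Subtype.val from funext hb]
    exact hli
  refine ⟨Submodule.span 𝕜 (Set.range b), ?_, disjoint_span_of_linearIndependent_mkQ hb'⟩
  have hbi : LinearIndependent 𝕜 b := hb'.of_comp
  rw [rank_span hbi, Cardinal.mk_range_eq b hbi.injective, hs]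

end Lineable

/-- If `F` is infinite-dimensional and meets `U` trivially, then there is a subspace of the same
dimension that meets `U` trivially and has a given vector of `U` in its closure. -/
theorem exists_rank_eq_disjoint_mem_closure {𝕜 : Type v} {V : Type u} [RCLike 𝕜]
    [NormedAddCommGroup V] [NormedSpace 𝕜 V] {U F : Submodule 𝕜 V} (hFU : Disjoint F U)
    (hF : Cardinal.aleph0 ≤ Module.rank 𝕜 F) {w : V} (hw : w ∈ U) :
    ∃ F' : Submodule 𝕜 V, Module.rank 𝕜 F' = Module.rank 𝕜 F ∧ Disjoint F' U ∧
      w ∈ closure (F' : Set V) := by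
  let b := Module.Basis.ofVectorSpace 𝕜 F
  set ι := Module.Basis.ofVectorSpaceIndex 𝕜 F
  have hι : Cardinal.mk ι = Module.rank 𝕜 F := b.mk_eq_rank''
  have : Infinite ι := by rwa [Cardinal.infinite_iff, hι]
  obtain ⟨e⟩ : Nonempty (ℕ ↪ ι) := ⟨Infinite.natEmbedding ι⟩
  have hscale : ∀ i, ∃ s : 𝕜ˣ, ∀ n, e n = i → ‖(s : 𝕜) • (b i : V)‖ ≤ 1 / ((n : ℝ) + 1) := by
    intro i
    by_cases hi : ∃ n, e n = i
    · obtain ⟨n, hn⟩ := hi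
      have h0 : (0 : ℝ) < (((n : ℝ) + 1) * (‖(b i : V)‖ + 1))⁻¹ := by positivity
      refine ⟨Units.mk0 (((((n : ℝ) + 1) * (‖(b i : V)‖ + 1))⁻¹ : ℝ) : 𝕜)
        (by exact_mod_cast h0.ne'), fun m hm => ?_⟩
      obtain rfl : m = n := e.injective (hm.trans hn.symm)
      rw [Units.val_mk0, norm_smul, RCLike.norm_ofReal, abs_of_pos h0, mul_inv, mul_assoc, one_div]
      refine mul_le_of_le_one_right (by positivity) ?_
      rw [inv_mul_le_one₀ (by positivity)]
      linarith
    · exact ⟨1, fun n hn => absurd ⟨n, hn⟩ hi⟩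
  choose s hs using hscale
  classical
  let b' : ι → V := fun i => (if i ∈ Set.range e then w else 0) + (s i : 𝕜) • (b i : V)
  have hmk : U.mkQ ∘ b' = s • (U.mkQ ∘ₗ F.subtype) ∘ b := by
    funext i
    have : U.mkQ (if i ∈ Set.range e then w else 0) = 0 := by
      split_ifs
      · exact (Submodule.Quotient.mk_eq_zero U).2 hw
      · exact map_zero _
    simp only [Function.comp_apply, b', map_add, this, zero_add, map_smul]
    rfl
  have hb' : LinearIndependent 𝕜 (U.mkQ ∘ b') := by
    rw [hmk]
    refine LinearIndependent.units_smul (b.linearIndependent.map' _ ?_) s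
    rw [LinearMap.ker_comp, Submodule.ker_mkQ, ← Submodule.disjoint_iff_comap_eq_bot]
    exact hFU
  have hbi : LinearIndependent 𝕜 b' := hb'.of_comp
  refine ⟨Submodule.span 𝕜 (Set.range b'), ?_, disjoint_span_of_linearIndependent_mkQ hb', ?_⟩
  · rw [rank_span hbi, Cardinal.mk_range_eq b' hbi.injective, hι]
  · refine mem_closure_of_tendsto (f := fun n => b' (e n)) (b := atTop) ?_
      (Eventually.of_forall fun n => Submodule.subset_span ⟨_, rfl⟩)
    rw [tendsto_iff_norm_sub_tendsto_zero]
    refine squeeze_zero (fun _ => norm_nonneg _) (fun n => ?_)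
      tendsto_one_div_add_atTop_nhds_zero_nat
    simpa [b'] using hs (e n) n rfl

theorem corollary2p7 {𝕜 : Type v} [RCLike 𝕜] {V : Type u} [NormedAddCommGroup V]
    [NormedSpace 𝕜 V] [CompleteSpace V]
    (W : ℕ → Submodule 𝕜 V) (U : Submodule 𝕜 V)
    (hU : (U : Set V) = ⋃ r, (W r : Set V))
    (hU_ne : U ≠ ⊥)
    (hU_codim : ¬ FiniteDimensional 𝕜 (V ⧸ U))
    (hW : ∀ r, ∃ p : Seminorm 𝕜 (W r), IsBanachNorm p ∧
      ∃ C : ℝ, 0 < C ∧ ∀ x : W r, ‖(x : V)‖ ≤ C * p x)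
    (α : Cardinal.{u}) :
    IsPairSpaceable 𝕜 α Cardinal.continuum (Set.univ \ ⋃ r, (W r : Set V)) ↔
      α < Cardinal.aleph0 := by
  rw [← hU]
  constructor
  · rintro ⟨⟨F, rfl, hF⟩, hext⟩
    rw [coe_diff_zero_subset_compl_iff] at hF
    by_contra! hα
    obtain ⟨w, hwU, hw0⟩ := Submodule.exists_mem_ne_zero_of_ne_bot hU_ne
    obtain ⟨F', hrank, hdisj, hmem⟩ := exists_rank_eq_disjoint_mem_closure hF hα hwU
    obtain ⟨G, -, hGcl, hFG, hG⟩ := hext F' (coe_subset_compl_union_zero_iff.2 hdisj) hrank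
    rw [coe_subset_compl_union_zero_iff] at hG
    exact hw0 (Submodule.disjoint_def.1 hG w (closure_minimal hFG hGcl hmem) hwU)
  · intro hα
    have hrank : Cardinal.aleph0 ≤ Module.rank 𝕜 (V ⧸ U) := by
      rwa [← not_lt, Module.rank_lt_aleph0_iff]
    refine ⟨?_, fun F hFU hFα => ?_⟩
    · obtain ⟨F, hF, hFU⟩ := exists_rank_eq_disjoint (hα.le.trans hrank)
      exact ⟨F, hF, coe_diff_zero_subset_compl_iff.2 hFU⟩
    rw [coe_subset_compl_union_zero_iff] at hFU
    have : FiniteDimensional 𝕜 F := by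
      rwa [← hFα, Module.rank_lt_aleph0_iff] at hα
    have hWU : ∀ r, W r ≤ U := fun r x hx => by
      have : x ∈ (U : Set V) := hU ▸ Set.mem_iUnion_of_mem r hx
      exact this
    choose p hp C _ hC using hW
    obtain ⟨G, hGcl, hGrank, hG⟩ := exists_isClosed_rank_eq_continuum
      (fun r h => hU_codim (Submodule.CoFG.of_le (hWU r) h)) hp hC F
    refine ⟨G ⊔ F, le_antisymm ?_ ?_, G.isClosed_sup_finiteDimensional F hGcl, le_sup_right, ?_⟩
    · refine (Submodule.rank_add_le_rank_add_rank G F).trans ?_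
      rw [hGrank, hFα]
      exact Cardinal.add_le_of_le Cardinal.aleph0_le_continuum le_rfl
        (hα.le.trans Cardinal.aleph0_le_continuum)
    · rw [← hGrank]
      exact Submodule.rank_mono le_sup_left
    · rw [coe_subset_compl_union_zero_iff, Submodule.disjoint_def]
      intro x hx hxU
      obtain ⟨g, hg, f, hf, rfl⟩ := Submodule.mem_sup.1 hx
      have hxU' : g + f ∈ (U : Set V) := hxU
      rw [hU] at hxU'
      -- Since g + f ∈ W r, also g ∈ W r + F, so g = 0; what remains lies in F ∩ U.
      obtain ⟨r, hr⟩ := Set.mem_iUnion.1 hxU'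
      have hg0 : g = 0 := Submodule.disjoint_def.1 (hG r) g hg (by
        simpa using sub_mem (Submodule.mem_sup_left hr) (Submodule.mem_sup_right hf : f ∈ W r ⊔ F))
      subst hg0
      rw [zero_add] at hxU ⊢
      exact Submodule.disjoint_def.1 hFU f hf hxU
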